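/- Let $k\ge 1$, let $I$ be a finite linearly ordered set and let $\lambda_{ij}\in\mathbb N$ for $i<j$ in $I$. Model $S^n$ as $[0,1]^n/\partial[0,1]^n$, write $\iota_i: S^{2k-1}\to\bigvee_{I}S^{2k-1}$ for the inclusion of the $i$-th summand, and identify $D^{4k-2}=[0,1]^{2k-1}\times[0,1]^{2k-1}$, with boundary sphere $S^{4k-3}$, and $S^{2k-1}\wedge S^{2k-1}=S^{4k-2}=D^{4k-2}/S^{4k-3}$ by $[s]\wedge[t]\mapsto[(s,t)]$. Let the Whitehead product $[\iota_i,\iota_j]_{\mathrm{Wh}}\in\pi_{4k-3}\big(\bigvee_I S^{2k-1}\big)$ be the class of the map $S^{4k-3}\to S^{2k-1}\vee S^{2k-1}\xrightarrow{(\iota_i,\iota_j)}\bigvee_I S^{2k-1}$, where the first map is the attaching map of the top cell of $S^{2k-1}\times S^{2k-1}$. Let $\phi: S^{4k-3}\to\bigvee_I S^{2k-1}$ be any pointed map whose class in $\pi_{4k-3}$ is $$\prod_{i<j}\big([\iota_i,\iota_j]_{\mathrm{Wh}}\big)^{\lambda_{ij}},$$ the factors being multiplied in any order (the order matters only for $k=1$).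 Let $$M=\Big(\bigvee_{I}S^{2k-1}\Big)\cup_\phi D^{4k-2},$$ and let $\mathrm{pr}_c: M\to M/\bigvee_I S^{2k-1}= S^{4k-2}$ be the quotient map. Then for every $j\in I$ the projection $\bigvee_I S^{2k-1}\to S^{2k-1}$ onto the $j$-th summand (the identity on that summand, constant on the others) extends to a continuous map $M\to S^{2k-1}$. Moreover, let $j<j'$ in $I$, and let $\mathrm{pr}_j,\mathrm{pr}_{j'}: M\to S^{2k-1}$ be any such extensions for $j$ and $j'$. Then the composite $$M\xrightarrow{\ \Delta\ }M\wedge M\xrightarrow{\ \mathrm{pr}_j\wedge\mathrm{pr}_{j'}\ }S^{2k-1}\wedge S^{2k-1}=S^{4k-2},$$ where $\Delta$ is the diagonal $M\to M\times M$ followed by the quotient map to the smash product, is homotopic, relative to the base point, to $\lambda_{jj'}\cdot\mathrm{pr}_c$, that is, to $\mathrm{pr}_c$ followed by a pointed self-map of $S^{4k-2}$ representing $\lambda_{jj'}\cdot[\mathrm{id}]\in\pi_{4k-2}(S^{4k-2})$. -/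

import Mathlib

open scoped unitInterval

namespace CellComplexSmash

noncomputable section

/-! ## Pointed quotients -/

/-- The relation on `X ⊔ {∗}` that identifies every point of `A` with the added point. -/
inductive PtQuot.Rel {X : Type*} (A : Set X) : X ⊕ Unit → X ⊕ Unit → Prop
  | glue (a : X) (ha : a ∈ A) : PtQuot.Rel A (Sum.inl a) (Sum.inr ())

/-- The pointed quotient space `X / A`: all points of `A` are identified to the base point.
For nonempty `A` this is the usual quotient space; `X / ∅` is `X` with a disjoint base point. -/
def PtQuot {X : Type*} (A : Set X) : Type _ := Quot (PtQuot.Rel A)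

namespace PtQuot

variable {X Y : Type*} [TopologicalSpace X] [TopologicalSpace Y] {A : Set X}

instance : TopologicalSpace (PtQuot A) :=
  inferInstanceAs (TopologicalSpace (Quot (PtQuot.Rel A)))

/-- The base point of `X / A`. -/
def pt : PtQuot A := Quot.mk _ (Sum.inr ())

/-- The quotient map `X → X / A`. -/
def mk : C(X, PtQuot A) where
  toFun x := Quot.mk _ (Sum.inl x)
  continuous_toFun := continuous_quot_mk.comp continuous_inl

theorem mk_eq_pt {a : X} (ha : a ∈ A) : (mk a : PtQuot A) = pt := Quot.sound (Rel.glue a ha)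

theorem isQuotientMap_quot :
    Topology.IsQuotientMap (Quot.mk (PtQuot.Rel A) : X ⊕ Unit → PtQuot A) :=
  isQuotientMap_quot_mk

theorem ind {P : PtQuot A → Prop} (hpt : P pt) (hmk : ∀ x, P (mk x)) (q : PtQuot A) : P q := by
  induction q using Quot.ind with
  | mk z =>
    rcases z with x | u
    · exact hmk x
    · exact hpt

/-- A continuous map on `X` that sends all of `A` to `y` descends to a pointed map on `X / A`. -/
def lift (f : C(X, Y)) (y : Y) (h : ∀ a ∈ A, f a = y) : C(PtQuot A, Y) where
  toFun := Quot.lift (Sum.elim f fun _ => y) (by rintro _ _ ⟨a, ha⟩; exact h a ha)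
  continuous_toFun := continuous_quot_lift _ (f.continuous.sumElim continuous_const)

@[simp] theorem lift_mk (f : C(X, Y)) (y : Y) (h : ∀ a ∈ A, f a = y) (x : X) :
    lift f y h (mk x) = f x := rfl

@[simp] theorem lift_pt (f : C(X, Y)) (y : Y) (h : ∀ a ∈ A, f a = y) :
    lift f y h (pt : PtQuot A) = y := rfl

end PtQuot

/-! ## Spheres -/

/-- The sphere of dimension `|N|`, in the model `I^N / ∂I^N`. Pointed maps out of it are the
generalized loops `GenLoop N X x`, of which `HomotopyGroup N X x` consists of the classes. -/
abbrev CubeSphere (N : Type*) : Type _ := PtQuot (Cube.boundary N)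

/-- The quotient map `I^N → I^N / ∂I^N` as a generalized loop; its class is that of the identity
map of the sphere. -/
def idLoop (N : Type*) : GenLoop N (CubeSphere N) PtQuot.pt :=
  ⟨PtQuot.mk, fun _ hy => PtQuot.mk_eq_pt hy⟩

/-- The pointed map out of the sphere that corresponds to a generalized loop. -/
def sphereMap {N X : Type*} [TopologicalSpace X] {x : X} (g : GenLoop N X x) :
    C(CubeSphere N, X) :=
  PtQuot.lift g.1 x g.2

/-- The class of a generalized loop in the homotopy group. -/
def loopClass {N X : Type*} [TopologicalSpace X] {x : X} (g : GenLoop N X x) :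
    HomotopyGroup N X x :=
  Quotient.mk (GenLoop.Homotopic.setoid N x) g

/-- A pointed self-map of the sphere that represents `d` times the class of the identity map in
the homotopy group of the sphere. -/
def multipleMap (N : Type*) [DecidableEq N] [Nonempty N] (d : ℕ) :
    C(CubeSphere N, CubeSphere N) :=
  sphereMap (Quotient.out (s := GenLoop.Homotopic.setoid N (PtQuot.pt : CubeSphere N))
    (loopClass (idLoop N) ^ d))

/-! ## Smash products -/

/-- The smash product of the pointed spaces `(X, x)` and `(Y, y)`. -/
abbrev Smash (X Y : Type*) [TopologicalSpace X] [TopologicalSpace Y] (x : X) (y : Y) : Type _ :=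
  PtQuot {p : X × Y | p.2 = y ∨ p.1 = x}

section Smash

variable {X Y X' Y' : Type*} [TopologicalSpace X] [TopologicalSpace Y] [TopologicalSpace X']
  [TopologicalSpace Y']

/-- The smash product of two pointed maps. -/
def Smash.map {x : X} {y : Y} {x' : X'} {y' : Y'} (f : C(X, X')) (g : C(Y, Y'))
    (hf : f x = x') (hg : g y = y') : C(Smash X Y x y, Smash X' Y' x' y') :=
  PtQuot.lift (PtQuot.mk.comp (f.prodMap g)) PtQuot.pt (by
    rintro ⟨a, b⟩ (h | h)
    · exact PtQuot.mk_eq_pt (Or.inl ((congrArg g h).trans hg))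
    · exact PtQuot.mk_eq_pt (Or.inr ((congrArg f h).trans hf)))

/-- The diagonal `X → X × X → X ∧ X`. -/
def smashDiagonal (x : X) : C(X, Smash X X x x) :=
  PtQuot.mk.comp ((ContinuousMap.id X).prodMk (ContinuousMap.id X))

end Smash

theorem continuous_bump {N : Type*} [Fintype N] :
    Continuous fun s : N → I => ∏ i, ((s i : ℝ) * (1 - s i)) := by fun_prop

theorem bump_eq_zero {N : Type*} [Fintype N] {s : N → I} :
    ∏ i, ((s i : ℝ) * (1 - s i)) = 0 ↔ s ∈ Cube.boundary N := by
  simp only [Finset.prod_eq_zero_iff, Finset.mem_univ, true_and, mul_eq_zero, sub_eq_zero]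
  constructor
  · rintro ⟨i, h | h⟩
    · exact ⟨i, Or.inl (Subtype.ext h)⟩
    · exact ⟨i, Or.inr (Subtype.ext h.symm)⟩
  · rintro ⟨i, h | h⟩
    · exact ⟨i, Or.inl (by simp [h])⟩
    · exact ⟨i, Or.inr (by simp [h])⟩

instance {N : Type*} [Finite N] : T2Space (CubeSphere N) := by
  have := Fintype.ofFinite N
  let b : (N → I) → ℝ := fun s => ∏ i, ((s i : ℝ) * (1 - s i))
  have hb : Continuous b := continuous_bump
  let F : C(N → I, ℝ × (N → ℝ)) := ⟨fun s => (b s, fun i => b s * s i), by fun_prop⟩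
  have hF0 : ∀ a ∈ Cube.boundary N, F a = 0 := by
    intro a ha
    have : b a = 0 := bump_eq_zero.2 ha
    simp only [F, ContinuousMap.coe_mk, this, zero_mul]
    rfl
  let G : C(CubeSphere N, ℝ × (N → ℝ)) := PtQuot.lift F 0 hF0
  have key : ∀ s : N → I, F s = 0 → (PtQuot.mk s : CubeSphere N) = PtQuot.pt := by
    intro s h
    exact PtQuot.mk_eq_pt (bump_eq_zero.1 (congrArg Prod.fst h))
  refine T2Space.of_injective_continuous (f := G) ?_ G.continuous
  intro p q
  induction p using PtQuot.ind with
  | hpt =>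
    induction q using PtQuot.ind with
    | hpt => exact fun _ => rfl
    | hmk t => exact fun h => (key t h.symm).symm
  | hmk s =>
    induction q using PtQuot.ind with
    | hpt => exact fun h => key s h
    | hmk t =>
      intro h
      change F s = F t at h
      by_cases h0 : F s = 0
      · rw [key s h0, key t (h ▸ h0)]
      · have hbs : b s ≠ 0 := by
          intro hb0
          exact h0 (hF0 s (bump_eq_zero.1 hb0))
        have h1 : b s = b t := congrArg Prod.fst h
        have h2 : ∀ i, b s * s i = b t * t i := fun i => congrFun (congrArg Prod.snd h) i
        congr 1
        funext i
        refine Subtype.ext (mul_left_cancel₀ hbs ?_)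
        rw [h2 i, h1]

instance {N : Type*} : CompactSpace (CubeSphere N) :=
  inferInstanceAs (CompactSpace (Quot (PtQuot.Rel (Cube.boundary N))))

/-- Concatenation of coordinates, `(I^N / ∂) × (I^N' / ∂) → I^(N ⊕ N') / ∂`. -/
def smashFun (N N' : Type*) (p : CubeSphere N) (q : CubeSphere N') : CubeSphere (N ⊕ N') :=
  Quot.lift (fun z : (N → I) ⊕ Unit => Sum.elim
      (fun s => PtQuot.lift (A := Cube.boundary N')
        (PtQuot.mk.comp ⟨fun t => Sum.elim s t, by
          refine continuous_pi fun i => ?_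
          rcases i with i | i
          · exact continuous_const
          · exact continuous_apply i⟩) PtQuot.pt
        (fun _ ha => PtQuot.mk_eq_pt (Cube.boundary_sum_iff.2 (Or.inr ha))) q)
      (fun _ => PtQuot.pt) z)
    (by
      rintro _ _ ⟨a, ha⟩
      induction q using PtQuot.ind with
      | hpt => rfl
      | hmk t =>
        exact PtQuot.mk_eq_pt (a := Sum.elim a t) (Cube.boundary_sum_iff.2 (Or.inl ha))) p

theorem smashFun_pt_right {N N' : Type*} (p : CubeSphere N) :
    smashFun N N' p PtQuot.pt = PtQuot.pt := by
  induction p using PtQuot.ind with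
  | hpt => rfl
  | hmk s => rfl

theorem continuous_smashFun (N N' : Type*) [Finite N] [Finite N'] :
    Continuous fun p : CubeSphere N × CubeSphere N' => smashFun N N' p.1 p.2 := by
  refine (PtQuot.isQuotientMap_quot (A := Cube.boundary N)).continuous_lift_prod_left ?_
  refine (PtQuot.isQuotientMap_quot (A := Cube.boundary N')).continuous_lift_prod_right ?_
  rw [← (Homeomorph.sumProdDistrib (X := N → I) (Y := Unit)
    (Z := (N' → I) ⊕ Unit)).symm.comp_continuous_iff']
  refine continuous_sum_dom.2 ⟨?_, ?_⟩
  · rw [← (Homeomorph.prodSumDistrib (X := N → I) (Y := N' → I)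
      (Z := Unit)).symm.comp_continuous_iff']
    refine continuous_sum_dom.2 ⟨?_, continuous_const⟩
    refine (PtQuot.mk (A := Cube.boundary (N ⊕ N'))).continuous.comp
      (f := fun p : (N → I) × (N' → I) => (Sum.elim p.1 p.2 : N ⊕ N' → I)) ?_
    refine continuous_pi fun i => ?_
    rcases i with i | i
    · exact (continuous_apply i).comp continuous_fst
    · exact (continuous_apply i).comp continuous_snd
  · exact continuous_const

/-- The standard identification of the smash product of two spheres with the sphere of the
summed dimension, `[s] ∧ [t] ↦ [(s, t)]`. -/
def smashSphere (N N' : Type*) [Finite N] [Finite N'] :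
    Smash (CubeSphere N) (CubeSphere N') PtQuot.pt PtQuot.pt ≃ₜ CubeSphere (N ⊕ N') where
  toFun := PtQuot.lift ⟨fun p => smashFun N N' p.1 p.2, continuous_smashFun N N'⟩ PtQuot.pt (by
    rintro ⟨p, q⟩ (h | h)
    · obtain rfl : q = PtQuot.pt := h
      exact smashFun_pt_right p
    · obtain rfl : p = PtQuot.pt := h
      rfl)
  invFun := PtQuot.lift
    ⟨fun s => PtQuot.mk (PtQuot.mk (s ∘ Sum.inl), PtQuot.mk (s ∘ Sum.inr)), by fun_prop⟩
    PtQuot.pt (by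
      intro s hs
      rcases Cube.boundary_sum_iff.1 hs with h | h
      · exact PtQuot.mk_eq_pt (Or.inr (PtQuot.mk_eq_pt h))
      · exact PtQuot.mk_eq_pt (Or.inl (PtQuot.mk_eq_pt h)))
  left_inv p := by
    induction p using PtQuot.ind with
    | hpt => rfl
    | hmk p =>
      obtain ⟨p, q⟩ := p
      induction p using PtQuot.ind with
      | hpt =>
        exact (PtQuot.mk_eq_pt (A := {p : CubeSphere N × CubeSphere N' |
          p.2 = PtQuot.pt ∨ p.1 = PtQuot.pt}) (a := (PtQuot.pt, q)) (Or.inr rfl)).symm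
      | hmk s =>
        induction q using PtQuot.ind with
        | hpt =>
          exact (PtQuot.mk_eq_pt (A := {p : CubeSphere N × CubeSphere N' |
            p.2 = PtQuot.pt ∨ p.1 = PtQuot.pt}) (a := (PtQuot.mk s, PtQuot.pt)) (Or.inl rfl)).symm
        | hmk t => rfl
  right_inv p := by
    induction p using PtQuot.ind with
    | hpt => rfl
    | hmk s => exact congrArg PtQuot.mk (Sum.elim_comp_inl_inr s)
  continuous_toFun := ContinuousMap.continuous _
  continuous_invFun := ContinuousMap.continuous _

theorem smashSphere_mk {N N' : Type*} [Finite N] [Finite N'] (s : N → I) (t : N' → I) :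
    smashSphere N N' (PtQuot.mk (PtQuot.mk s, PtQuot.mk t)) = PtQuot.mk (Sum.elim s t) := rfl

/-! ## The boundary of a cube as a sphere -/

section Boundary

variable {K L : Type*}

/-- For `s` in the cube `I^L`, the point of the cube nearest to `3 s - 1`. This is the affine
expansion of the middle subcube `[1/3, 2/3]^L` to the whole cube. -/
def expand (s : L → I) : L → I := fun i => Set.projIcc 0 1 zero_le_one (3 * (s i : ℝ) - 1)

theorem continuous_expand : Continuous (expand : (L → I) → L → I) := by
  unfold expand
  refine continuous_pi fun i => continuous_projIcc.comp ?_
  fun_prop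

variable [Fintype L] (e : K ≃ Option L)

/-- The sup-distance of `3 s - 1` from the cube. It is `0` on the middle subcube and `1` on the
boundary. -/
def excess (s : L → I) : ℝ := ‖fun i => 3 * (s i : ℝ) - 1 - (expand s i : ℝ)‖

/-- With the coordinates `K` of a cube split by `e` into the coordinates `L` and one more, the
"height": the map `I^L → I^K` with image in the boundary which maps the middle subcube
affinely onto the top face (height `1`), the layer around it onto the walls, and the outermost
layer onto the bottom face, contracting the boundary of `I^L` to the vertex `0`. -/
def wrap (s : L → I) : K → I := fun κ =>
  match e κ with
  | none => Set.projIcc 0 1 zero_le_one (1 - 2 * excess s)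
  | some i => Set.projIcc 0 1 zero_le_one (2 - 2 * excess s) * expand s i

theorem continuous_excess : Continuous (excess : (L → I) → ℝ) := by
  unfold excess
  refine continuous_norm.comp (continuous_pi fun i => ?_)
  have := (continuous_apply i).comp (continuous_expand (L := L))
  have h : Continuous fun s : L → I => (expand s i : ℝ) := continuous_subtype_val.comp this
  fun_prop

theorem continuous_wrap : Continuous (wrap e) := by
  have h := continuous_excess (L := L)
  refine continuous_pi fun κ => ?_
  unfold wrap
  cases e κ with
  | none => exact continuous_projIcc.comp (by fun_prop)
  | some i =>
    exact (continuous_projIcc.comp (by fun_prop)).mul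
      ((continuous_apply i).comp continuous_expand)

theorem excess_nonneg (s : L → I) : 0 ≤ excess s := norm_nonneg _

theorem one_le_excess {s : L → I} (hs : s ∈ Cube.boundary L) : 1 ≤ excess s := by
  obtain ⟨i, h⟩ := hs
  refine le_trans ?_ (norm_le_pi_norm (fun i => 3 * (s i : ℝ) - 1 - (expand s i : ℝ)) i)
  rw [Real.norm_eq_abs]
  rcases h with h | h
  · have : (expand s i : ℝ) = 0 := by
      simp [expand, h, Set.coe_projIcc]
    rw [this, h]; norm_num
  · have : (expand s i : ℝ) = 1 := by
      simp only [expand, h, Set.coe_projIcc, Set.Icc.coe_one]; norm_num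
    rw [this, h]; norm_num

theorem expand_mem_boundary {s : L → I} (h : excess s ≠ 0) : expand s ∈ Cube.boundary L := by
  by_contra hc
  apply h
  unfold excess
  rw [norm_eq_zero]
  funext i
  have h0 : expand s i ≠ 0 := fun h => hc ⟨i, Or.inl h⟩
  have h1 : expand s i ≠ 1 := fun h => hc ⟨i, Or.inr h⟩
  have hlow : 0 < 3 * (s i : ℝ) - 1 := by
    by_contra hle
    exact h0 (Set.projIcc_of_le_left zero_le_one (not_lt.1 hle))
  have hhigh : 3 * (s i : ℝ) - 1 < 1 := by
    by_contra hle
    exact h1 (Set.projIcc_of_right_le zero_le_one (not_lt.1 hle))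
  have : (expand s i : ℝ) = 3 * (s i : ℝ) - 1 := by
    simp only [expand]
    rw [Set.projIcc_of_mem zero_le_one ⟨hlow.le, hhigh.le⟩]
  simp [this]

theorem wrap_mem_boundary (s : L → I) : wrap e s ∈ Cube.boundary K := by
  by_cases h0 : excess s = 0
  · refine ⟨e.symm none, Or.inr ?_⟩
    simp only [wrap, Equiv.apply_symm_apply, h0]
    exact Set.projIcc_of_right_le zero_le_one (by norm_num)
  by_cases h1 : excess s ≤ 1 / 2
  · obtain ⟨i, hi⟩ := expand_mem_boundary h0
    refine ⟨e.symm (some i), ?_⟩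
    have : Set.projIcc (0 : ℝ) 1 zero_le_one (2 - 2 * excess s) = 1 :=
      Set.projIcc_of_right_le zero_le_one (by linarith)
    simpa only [wrap, Equiv.apply_symm_apply, this, one_mul] using hi
  · refine ⟨e.symm none, Or.inl ?_⟩
    simp only [wrap, Equiv.apply_symm_apply]
    exact Set.projIcc_of_le_left zero_le_one (by linarith)

theorem wrap_of_mem_boundary {s : L → I} (hs : s ∈ Cube.boundary L) : wrap e s = 0 := by
  have h := one_le_excess hs
  funext κ
  simp only [wrap, Pi.zero_apply]
  cases e κ with
  | none => exact Set.projIcc_of_le_left zero_le_one (by linarith)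
  | some i =>
    have : Set.projIcc (0 : ℝ) 1 zero_le_one (2 - 2 * excess s) = 0 :=
      Set.projIcc_of_le_left zero_le_one (by linarith)
    simp only [this, zero_mul]

/-- The vertex `0` of the cube `I^K`, as base point of the boundary. -/
def vertex : Cube.boundary K := ⟨0, ⟨e.symm none, Or.inl rfl⟩⟩

/-- The generalized loop in `X` given by a pointed map from the boundary of a cube to `X`, by
means of the standard map `I^L / ∂I^L → ∂I^K` of degree one. -/
def boundaryLoop {X : Type*} [TopologicalSpace X] {x : X} (φ : C(Cube.boundary K, X))
    (hφ : φ (vertex e) = x) : GenLoop L X x :=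
  ⟨φ.comp ⟨fun s => ⟨wrap e s, wrap_mem_boundary e s⟩, (continuous_wrap e).subtype_mk _⟩,
    fun s hs => by
      rw [← hφ]
      exact congrArg φ (Subtype.ext (wrap_of_mem_boundary e hs))⟩

end Boundary

/-! ## Whitehead products -/

section Whitehead

variable {N N' : Type*} {X : Type*} [TopologicalSpace X] {x : X}

theorem isClosed_boundary (N : Type*) [Finite N] : IsClosed (Cube.boundary N) := by
  have : Cube.boundary N = ⋃ i : N, {y : N → I | y i = 0 ∨ y i = 1} := by
    ext y; simp [Cube.boundary]
  rw [this]
  refine isClosed_iUnion_of_finite fun i => ?_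
  exact (isClosed_eq (continuous_apply i) continuous_const).union
    (isClosed_eq (continuous_apply i) continuous_const)

open Classical in
/-- The composite `∂(I^N × I^N') → S^N ∨ S^N' → X` of the attaching map of the top cell of
`S^N × S^N'` with the map given by `α` and `β`: a point `(s, t)` is sent to `α s` if `t` is in
the boundary and to `β t` if `s` is in the boundary. -/
def whiteheadFun (α : GenLoop N X x) (β : GenLoop N' X x) (y : Cube.boundary (N ⊕ N')) : X :=
  if y.1 ∘ Sum.inr ∈ Cube.boundary N' then α (y.1 ∘ Sum.inl) else β (y.1 ∘ Sum.inr)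

theorem whiteheadFun_left (α : GenLoop N X x) (β : GenLoop N' X x) (y : Cube.boundary (N ⊕ N'))
    (h : y.1 ∘ Sum.inr ∈ Cube.boundary N') : whiteheadFun α β y = α (y.1 ∘ Sum.inl) :=
  if_pos h

theorem whiteheadFun_right (α : GenLoop N X x) (β : GenLoop N' X x)
    (y : Cube.boundary (N ⊕ N')) (h : y.1 ∘ Sum.inl ∈ Cube.boundary N) :
    whiteheadFun α β y = β (y.1 ∘ Sum.inr) := by
  by_cases h' : y.1 ∘ Sum.inr ∈ Cube.boundary N'
  · rw [whiteheadFun_left α β y h', GenLoop.boundary α _ h, GenLoop.boundary β _ h']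
  · exact if_neg h'

theorem continuous_whiteheadFun [Finite N] [Finite N'] (α : GenLoop N X x)
    (β : GenLoop N' X x) : Continuous (whiteheadFun α β) := by
  have hl : Continuous fun y : Cube.boundary (N ⊕ N') => y.1 ∘ Sum.inl :=
    continuous_pi fun i => (continuous_apply (Sum.inl i)).comp continuous_subtype_val
  have hr : Continuous fun y : Cube.boundary (N ⊕ N') => y.1 ∘ Sum.inr :=
    continuous_pi fun i => (continuous_apply (Sum.inr i)).comp continuous_subtype_val
  rw [← continuousOn_univ]
  have hu : (Set.univ : Set (Cube.boundary (N ⊕ N'))) =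
      {y | y.1 ∘ Sum.inl ∈ Cube.boundary N} ∪ {y | y.1 ∘ Sum.inr ∈ Cube.boundary N'} := by
    ext y
    simpa using Cube.boundary_sum_iff.1 y.2
  rw [hu]
  refine ContinuousOn.union_of_isClosed ?_ ?_ ((isClosed_boundary N).preimage hl)
    ((isClosed_boundary N').preimage hr)
  · exact ((β.1.continuous.comp hr).continuousOn).congr
      fun y hy => whiteheadFun_right α β y hy
  · exact ((α.1.continuous.comp hl).continuousOn).congr
      fun y hy => whiteheadFun_left α β y hy

variable {L : Type*} [Fintype L]

/-- The Whitehead product of (the classes of) `α` and `β`. -/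
def whiteheadProduct [Finite N] [Finite N'] [Nonempty N] [Nonempty N'] (e : N ⊕ N' ≃ Option L)
    (α : GenLoop N X x) (β : GenLoop N' X x) : HomotopyGroup L X x :=
  loopClass (boundaryLoop e ⟨whiteheadFun α β, continuous_whiteheadFun α β⟩ (by
    obtain ⟨i⟩ := ‹Nonempty N›
    obtain ⟨j⟩ := ‹Nonempty N'›
    exact (whiteheadFun_left α β _ ⟨j, Or.inl rfl⟩).trans (GenLoop.boundary α _ ⟨i, Or.inl rfl⟩)))

end Whitehead

/-! ## Wedges of spheres and the attachment of a cell -/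

/-- The wedge of a family, indexed by `J`, of copies of the sphere `I^N / ∂I^N`. -/
abbrev SphereWedge (J N : Type*) : Type _ :=
  PtQuot {p : Σ _ : J, CubeSphere N | p.2 = PtQuot.pt}

/-- The class of the inclusion of the `j`-th sphere into the wedge is that of this loop. -/
def wedgeLoop {J : Type*} (N : Type*) (j : J) : GenLoop N (SphereWedge J N) PtQuot.pt :=
  ⟨PtQuot.mk.comp ⟨fun s => ⟨j, PtQuot.mk s⟩,
    continuous_sigmaMk.comp (PtQuot.mk (A := Cube.boundary N)).continuous⟩, fun _ hy =>
    PtQuot.mk_eq_pt (PtQuot.mk_eq_pt hy)⟩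

/-- The projection of the wedge onto the `j`-th sphere: the identity on that sphere, constant
on all others. -/
def wedgeProj {J : Type*} [DecidableEq J] (N : Type*) (j : J) :
    C(SphereWedge J N, CubeSphere N) :=
  PtQuot.lift ⟨fun p => if p.1 = j then p.2 else PtQuot.pt, by
    refine continuous_sigma fun i => ?_
    by_cases h : i = j
    · simpa [h] using continuous_id'
    · simpa [h] using continuous_const⟩ PtQuot.pt (by
    rintro ⟨i, p⟩ (rfl : p = PtQuot.pt)
    simp)

/-- The gluing relation of the pushout of `X ← ∂I^K → I^K`. -/
inductive AttachCell.Rel {K X : Type*} [TopologicalSpace X] (φ : C(Cube.boundary K, X)) :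
    X ⊕ (K → I) → X ⊕ (K → I) → Prop
  | glue (b : Cube.boundary K) : AttachCell.Rel φ (Sum.inr b.1) (Sum.inl (φ b))

/-- The space obtained from `X` by attaching the cell `I^K` along `φ : ∂I^K → X`. -/
def AttachCell {K X : Type*} [TopologicalSpace X] (φ : C(Cube.boundary K, X)) : Type _ :=
  Quot (AttachCell.Rel φ)

namespace AttachCell

variable {K X : Type*} [TopologicalSpace X] (φ : C(Cube.boundary K, X))

instance : TopologicalSpace (AttachCell φ) :=
  inferInstanceAs (TopologicalSpace (Quot (AttachCell.Rel φ)))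

/-- The inclusion of `X`. -/
def incl : C(X, AttachCell φ) where
  toFun x := Quot.mk _ (Sum.inl x)
  continuous_toFun := continuous_quot_mk.comp continuous_inl

/-- The characteristic map of the attached cell. -/
def cell : C(K → I, AttachCell φ) where
  toFun s := Quot.mk _ (Sum.inr s)
  continuous_toFun := continuous_quot_mk.comp continuous_inr

/-- The map that collapses `X` to a point, leaving `I^K / ∂I^K`. -/
def collapse : C(AttachCell φ, CubeSphere K) where
  toFun := Quot.lift (Sum.elim (fun _ => PtQuot.pt) PtQuot.mk) (by
    rintro _ _ ⟨b⟩
    exact PtQuot.mk_eq_pt b.2)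
  continuous_toFun :=
    continuous_quot_lift _
      (continuous_const.sumElim (PtQuot.mk (A := Cube.boundary K)).continuous)

theorem collapse_incl (x : X) : collapse φ (incl φ x) = PtQuot.pt := rfl

theorem collapse_cell (s : K → I) : collapse φ (cell φ s) = PtQuot.mk s := rfl

end AttachCell

/-! ## The complexes under consideration -/

instance (k : ℕ) [NeZero k] : NeZero (2 * k - 1) :=
  ⟨by have := NeZero.ne k; omega⟩

instance (k : ℕ) [NeZero k] : NeZero (4 * k - 3) :=
  ⟨by have := NeZero.ne k; omega⟩

/-- The coordinates of `I^(2k-1) × I^(2k-1)` are `4k-3` coordinates and a last one. -/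
def coords (k : ℕ) [NeZero k] : Fin (2 * k - 1) ⊕ Fin (2 * k - 1) ≃ Option (Fin (4 * k - 3)) :=
  (finSumFinEquiv.trans (finCongr (by have := NeZero.ne k; omega))).trans finSuccEquivLast

/-- The boundary sphere `S^(4k-3)` of the disk `D^(4k-2) = I^(2k-1) × I^(2k-1)`. -/
abbrev BdSphere (k : ℕ) : Type := Cube.boundary (Fin (2 * k - 1) ⊕ Fin (2 * k - 1))

/-- The wedge of spheres `S^(2k-1)` indexed by `J`. -/
abbrev Wedge (k : ℕ) (J : Type*) : Type _ := SphereWedge J (Fin (2 * k - 1))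

/-- The Whitehead product `[ι_i, ι_j]` in `π_{4k-3}(⋁ S^(2k-1))`. -/
def whiteheadBracket (k : ℕ) [NeZero k] {J : Type*} (i j : J) :
    HomotopyGroup (Fin (4 * k - 3)) (Wedge k J) PtQuot.pt :=
  whiteheadProduct (coords k) (wedgeLoop (Fin (2 * k - 1)) i) (wedgeLoop (Fin (2 * k - 1)) j)

/-- The pointed map `φ : S^(4k-3) → ⋁ S^(2k-1)` represents the product of the powers
`[ι_i, ι_j] ^ lam i j` over all pairs `i < j`, the factors being taken in some order (which is
relevant only for `k = 1`, where `π_1` is not abelian). -/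
def IsProductOfBrackets (k : ℕ) [NeZero k] {J : Type*} [LinearOrder J] (lam : J → J → ℕ)
    (φ : C(BdSphere k, Wedge k J)) : Prop :=
  ∃ (h : φ (vertex (coords k)) = PtQuot.pt) (l : List (J × J)),
    l.Nodup ∧ (∀ p : J × J, p ∈ l ↔ p.1 < p.2) ∧
    loopClass (boundaryLoop (coords k) φ h) =
      (l.map fun p => whiteheadBracket k p.1 p.2 ^ lam p.1 p.2).prod

/-- The base point of `M`. -/
def basePoint {k : ℕ} {J : Type*} (φ : C(BdSphere k, Wedge k J)) : AttachCell φ :=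
  AttachCell.incl φ PtQuot.pt

/-- The maps `pr_j : M → S^(2k-1)`: the extensions to the cell of the projection of the wedge
onto its `j`-th summand. -/
def CellProjection {k : ℕ} {J : Type*} [DecidableEq J] (φ : C(BdSphere k, Wedge k J)) (j : J) :
    Type _ :=
  {f : C(AttachCell φ, CubeSphere (Fin (2 * k - 1))) //
    ∀ w, f (AttachCell.incl φ w) = wedgeProj (Fin (2 * k - 1)) j w}

theorem CellProjection.map_basePoint {k : ℕ} {J : Type*} [DecidableEq J]
    {φ : C(BdSphere k, Wedge k J)} {j : J} (f : CellProjection φ j) :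
    f.1 (basePoint φ) = PtQuot.pt :=
  f.2 PtQuot.pt

/-- The composite `M → M ∧ M → S^(2k-1) ∧ S^(2k-1) = S^(4k-2)` of the smash diagonal with
`pr_i ∧ pr_j`. -/
def smashOfProjections {k : ℕ} {J : Type*} [DecidableEq J] {φ : C(BdSphere k, Wedge k J)}
    {i j : J} (f : CellProjection φ i) (g : CellProjection φ j) :
    C(AttachCell φ, CubeSphere (Fin (2 * k - 1) ⊕ Fin (2 * k - 1))) :=
  (ContinuousMap.comp ⟨smashSphere _ _, (smashSphere _ _).continuous⟩
    (Smash.map f.1 g.1 f.map_basePoint g.map_basePoint)).comp (smashDiagonal (basePoint φ))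

end

end CellComplexSmash

open CellComplexSmash

/-! Split the coordinates of the cell into a height and a base cube. Let `r` be a projection of the
wedge, or a pair of them, with values in `Z`. A filling of a loop `γ` in the wedge is a null
homotopy of `r ∘ γ`; a map `m` on `Z` turns it into a map on the cell. `Represents` records that a
class `C` has a representative with a filling whose image under `m` has class `c`. This relation is
multiplicative, since fillings can be concatenated in a base direction (`Represents.mul`).

For `[ι_a, ι_b]` a filling comes from coordinates: the projection of the attaching map to summand
`j` extends over the cube as the first factor, the second factor, or a constant (`bracketProj`).
Hence every projection kills every bracket, and so extends over the cell. For the pair `(j, j')` and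
`m` the map to the smash product, the image of the filling is the identity class if `(a, b) = (j,
j')` and trivial otherwise, so the product of brackets gives `λ_{jj'}` times the identity.

Any other extensions give a filling with the same image class: two fillings of one loop glue to a
sphere in the product, and a sphere in a product dies in the smash product, because its components
can be moved in disjoint time intervals (`loopClass_pairing`, `IsFilling.loopClass_eq`). Both maps
in the theorem are constant on the wedge, so comparing them on the cell suffices.

Maps on the boundary of the cube are related to loops by `coneMap`, which is homotopic to the
identity through boundary-preserving maps. -/

namespace CellComplexSmash

/-! ## Concatenation of maps on cubes -/

section Concat

variable {K Z Y : Type*} [DecidableEq K] [TopologicalSpace Z] [TopologicalSpace Y]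

/-- The concatenation in the direction `κ` of two maps on a cube, where the restriction of the
first to the face `κ = 1` agrees with that of the second to the face `κ = 0`. -/
noncomputable def cubeConcat (κ : K) (f g : C(K → I, Z))
    (H : ∀ y, f (Function.update y κ 1) = g (Function.update y κ 0)) : C(K → I, Z) where
  toFun t := if (t κ : ℝ) ≤ 1 / 2
    then f (Function.update t κ (Set.projIcc 0 1 zero_le_one (2 * (t κ : ℝ))))
    else g (Function.update t κ (Set.projIcc 0 1 zero_le_one (2 * (t κ : ℝ) - 1)))
  continuous_toFun := by
    refine Continuous.if_le ?_ ?_ (by fun_prop) continuous_const ?_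
    · exact f.continuous.comp (continuous_id.update κ (continuous_projIcc.comp (by fun_prop)))
    · exact g.continuous.comp (continuous_id.update κ (continuous_projIcc.comp (by fun_prop)))
    · intro t ht
      have h1 : Set.projIcc (0 : ℝ) 1 zero_le_one (2 * (t κ : ℝ)) = 1 :=
        Set.projIcc_of_right_le _ (by rw [ht]; norm_num)
      have h0 : Set.projIcc (0 : ℝ) 1 zero_le_one (2 * (t κ : ℝ) - 1) = 0 :=
        Set.projIcc_of_le_left _ (by rw [ht]; norm_num)
      rw [h1, h0, H]

variable {κ : K} {f g : C(K → I, Z)}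
  {H : ∀ y, f (Function.update y κ 1) = g (Function.update y κ 0)}

theorem cubeConcat_of_eq_zero {t : K → I} (ht : t κ = 0) : cubeConcat κ f g H t = f t := by
  have h0 : Set.projIcc (0 : ℝ) 1 zero_le_one (2 * (t κ : ℝ)) = t κ := by
    rw [ht]; exact Set.projIcc_of_le_left _ (by simp)
  change ite _ _ _ = _
  rw [if_pos (by rw [ht]; norm_num), h0, Function.update_eq_self]

theorem cubeConcat_of_eq_one {t : K → I} (ht : t κ = 1) : cubeConcat κ f g H t = g t := by
  have h0 : Set.projIcc (0 : ℝ) 1 zero_le_one (2 * (t κ : ℝ) - 1) = t κ := by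
    rw [ht]; exact Set.projIcc_of_right_le _ (by norm_num)
  change ite _ _ _ = _
  rw [if_neg (by rw [ht]; norm_num), h0, Function.update_eq_self]

/-- A property of values that holds for both maps at all points with the same coordinates other
than `κ`, holds for the concatenation. -/
theorem cubeConcat_induction {P : Z → Prop} {t : K → I}
    (hf : ∀ v, P (f (Function.update t κ v))) (hg : ∀ v, P (g (Function.update t κ v))) :
    P (cubeConcat κ f g H t) := by
  change P (ite _ _ _)
  split_ifs
  · exact hf _
  · exact hg _

/-- `cubeConcat` has the same formula as `transAt`, but its pieces need not be loops in `Z`; only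
their images under `m` are. -/
theorem map_cubeConcat (m : C(Z, Y)) {y : Y} {F G : GenLoop K Y y} (hF : ∀ t, F t = m (f t))
    (hG : ∀ t, G t = m (g t)) (t : K → I) :
    GenLoop.transAt κ F G t = m (cubeConcat κ f g H t) := by
  change ite _ _ _ = m (ite _ _ _)
  rw [apply_ite m, ← hF, ← hG]

end Concat

/-! ## Classes of generalized loops -/

section Classes

variable {K Y : Type*} [TopologicalSpace Y] {y : Y}

theorem loopClass_eq_iff {F G : GenLoop K Y y} :
    loopClass F = loopClass G ↔ GenLoop.Homotopic F G := Quotient.eq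

variable [DecidableEq K] [Nonempty K]

theorem loopClass_const : loopClass (GenLoop.const : GenLoop K Y y) = 1 := rfl

/-- The order is reversed, and the direction `κ` is free; concatenation is used both in base
directions and in the height. -/
theorem loopClass_transAt (κ : K) (F G : GenLoop K Y y) :
    loopClass (GenLoop.transAt κ F G) = loopClass G * loopClass F :=
  (HomotopyGroup.mul_spec (i := κ) (p := G) (q := F)).symm

theorem loopClass_symmAt (κ : K) (F : GenLoop K Y y) :
    loopClass (GenLoop.symmAt κ F) = (loopClass F)⁻¹ :=
  (HomotopyGroup.inv_spec (i := κ) (p := F)).symm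

/-- The image of a pair of generalized loops under a map that is constant on the axes is trivial. -/
theorem loopClass_pairing {A B : Type*} [TopologicalSpace A] [TopologicalSpace B] {a : A} {b : B}
    (m : C(A × B, Y)) (hl : ∀ t, m (t, b) = y) (hr : ∀ t, m (a, t) = y)
    (f : GenLoop K A a) (g : GenLoop K B b) (G : GenLoop K Y y) (hG : ∀ t, G t = m (f t, g t)) :
    loopClass G = 1 := by
  let κ : K := Classical.arbitrary K
  -- With `f` moved to the first half and `g` to the second, one component is always at its base
  -- point, where `m` is constant.
  have hf : GenLoop.Homotopic f (GenLoop.transAt κ f GenLoop.const) := by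
    rw [← loopClass_eq_iff, loopClass_transAt, loopClass_const, one_mul]
  have hg : GenLoop.Homotopic g (GenLoop.transAt κ GenLoop.const g) := by
    rw [← loopClass_eq_iff, loopClass_transAt, loopClass_const, mul_one]
  rw [← loopClass_const, loopClass_eq_iff]
  obtain ⟨Hf⟩ := hf
  obtain ⟨Hg⟩ := hg
  have h := ContinuousMap.HomotopicRel.comp_continuousMap ⟨Hf.prod Hg⟩ m
  have e1 : m.comp (ContinuousMap.prodMk f.1 g.1) = G.1 :=
    ContinuousMap.ext fun t => (hG t).symm
  have e2 : m.comp (ContinuousMap.prodMk (GenLoop.transAt κ f GenLoop.const).1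
      (GenLoop.transAt κ GenLoop.const g).1) = (GenLoop.const : GenLoop K Y y).1 := by
    ext t
    change m (ite _ _ _, ite _ _ _) = y
    split_ifs
    · exact hl _
    · exact hr _
  rw [e1, e2] at h
  exact h

end Classes

/-! ## Fillings of generalized loops -/

section Filling

variable {K L X Z Y : Type*} [TopologicalSpace X] [TopologicalSpace Z] [TopologicalSpace Y]
  {x : X} {z : Z} {y : Y} (e : K ≃ Option L) (r : C(X, Z)) (m : C(Z, Y))

/-- The coordinates of a point of the cube `I^K` other than the height. -/
def base (t : K → I) : L → I := fun l => t (e.symm (some l))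

theorem continuous_base : Continuous (base e) := by
  unfold base; fun_prop

theorem mem_boundary_iff_base {t : K → I} :
    t ∈ Cube.boundary K ↔
      t (e.symm none) = 0 ∨ t (e.symm none) = 1 ∨ base e t ∈ Cube.boundary L := by
  constructor
  · rintro ⟨κ, h⟩
    obtain ⟨o, rfl⟩ := e.symm.surjective κ
    rcases o with _ | l
    · exact h.imp id Or.inl
    · exact Or.inr (Or.inr ⟨l, h⟩)
  · rintro (h | h | ⟨l, h⟩)
    · exact ⟨_, Or.inl h⟩
    · exact ⟨_, Or.inr h⟩
    · exact ⟨_, h⟩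

theorem base_update_none [DecidableEq K] (t : K → I) (v : I) :
    base e (Function.update t (e.symm none) v) = base e t := by
  funext l
  exact Function.update_of_ne (by simp) _ _

theorem base_update_some [DecidableEq K] [DecidableEq L] (t : K → I) (l : L) (v : I) :
    base e (Function.update t (e.symm (some l)) v) = Function.update (base e t) l v := by
  funext i
  by_cases h : i = l
  · subst h; simp [base]
  · simp [base, Function.update_of_ne, h]

/-- `h` is a null homotopy of the image under `r` of the generalized loop `γ`, with the homotopy
parameter as the height. -/
structure IsFilling (z : Z) (γ : GenLoop L X x) (h : C(K → I, Z)) : Prop where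
  bottom : ∀ t, t (e.symm none) = 0 → h t = z
  wall : ∀ t, base e t ∈ Cube.boundary L → h t = z
  top : ∀ t, t (e.symm none) = 1 → h t = r (γ (base e t))

/-- The class `C` has a null homotopy of its image under `r` which, followed by `m`, has the
class `c`. -/
def Represents (z : Z) (C : HomotopyGroup L X x) (c : HomotopyGroup K Y y) : Prop :=
  ∃ (γ : GenLoop L X x) (h : C(K → I, Z)) (G : GenLoop K Y y), IsFilling e r z γ h ∧
    loopClass γ = C ∧ (∀ t, G t = m (h t)) ∧ loopClass G = c

variable {e r m}

theorem represents_one [DecidableEq K] [DecidableEq L] [Nonempty K] [Nonempty L]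
    (hr : r x = z) (hm : m z = y) :
    Represents e r m z (1 : HomotopyGroup L X x) (1 : HomotopyGroup K Y y) :=
  ⟨GenLoop.const, ContinuousMap.const _ z, GenLoop.const,
    ⟨fun _ _ => rfl, fun _ _ => rfl, fun _ _ => hr.symm⟩, rfl, fun _ => hm.symm, rfl⟩

/-- Concatenation in a base direction leaves the height alone, so the result is again a filling, of
the concatenated loop. -/
theorem Represents.mul [DecidableEq K] [DecidableEq L] [Nonempty K] [Nonempty L]
    {C D : HomotopyGroup L X x} {c d : HomotopyGroup K Y y}
    (hC : Represents e r m z C c) (hD : Represents e r m z D d) :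
    Represents e r m z (C * D) (c * d) := by
  obtain ⟨γ, h, G, hh, rfl, hG, rfl⟩ := hC
  obtain ⟨γ', h', G', hh', rfl, hG', rfl⟩ := hD
  let l : L := Classical.arbitrary L
  let κ : K := e.symm (some l)
  have hne : e.symm none ≠ κ := by simp [κ]
  have mem : ∀ (t : K → I) (v : I), (v = 0 ∨ v = 1) →
      base e (Function.update t κ v) ∈ Cube.boundary L := fun t v hv =>
    ⟨l, by simpa only [κ, base_update_some, Function.update_self] using hv⟩
  -- The faces to be glued are walls, on which both fillings equal `z`.
  have H : ∀ t, h' (Function.update t κ 1) = h (Function.update t κ 0) := fun t =>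
    (hh'.wall _ (mem t 1 (Or.inr rfl))).trans (hh.wall _ (mem t 0 (Or.inl rfl))).symm
  -- The primed factor comes first, to compensate the reversed order in `loopClass_transAt`.
  refine ⟨GenLoop.transAt l γ' γ, cubeConcat κ h' h H, GenLoop.transAt κ G' G, ⟨?_, ?_, ?_⟩,
    loopClass_transAt _ _ _, map_cubeConcat m hG' hG, loopClass_transAt _ _ _⟩
  · intro t ht
    refine cubeConcat_induction (P := fun w => w = z) (fun v => hh'.bottom _ ?_)
      (fun v => hh.bottom _ ?_) <;> rwa [Function.update_of_ne hne]
  · rintro t ⟨i, hi⟩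
    by_cases hil : i = l
    · subst hil
      rcases hi with hi | hi
      · rw [cubeConcat_of_eq_zero (κ := κ) (t := t) hi]
        exact hh'.wall _ ⟨_, Or.inl hi⟩
      · rw [cubeConcat_of_eq_one (κ := κ) (t := t) hi]
        exact hh.wall _ ⟨_, Or.inr hi⟩
    · refine cubeConcat_induction (P := fun w => w = z) (fun v => hh'.wall _ ⟨i, ?_⟩)
        (fun v => hh.wall _ ⟨i, ?_⟩) <;>
      rwa [base_update_some, Function.update_of_ne hil]
  · intro t ht
    have e1 : ∀ v, h (Function.update t κ v) = r (γ (Function.update (base e t) l v)) := by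
      intro v
      rw [hh.top _ (by rwa [Function.update_of_ne hne]), base_update_some]
    have e2 : ∀ v, h' (Function.update t κ v) = r (γ' (Function.update (base e t) l v)) := by
      intro v
      rw [hh'.top _ (by rwa [Function.update_of_ne hne]), base_update_some]
    change ite _ _ _ = r (ite _ _ _)
    rw [apply_ite r, e1, e2]
    rfl

theorem Represents.pow [DecidableEq K] [DecidableEq L] [Nonempty K] [Nonempty L]
    (hr : r x = z) (hm : m z = y) {C : HomotopyGroup L X x} {c : HomotopyGroup K Y y}
    (hC : Represents e r m z C c) (n : ℕ) : Represents e r m z (C ^ n) (c ^ n) := by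
  induction n with
  | zero => simpa using represents_one hr hm
  | succ n ih => rw [pow_succ, pow_succ]; exact ih.mul hC

/-- The order of factors is the same on both sides, so no commutativity is needed; this covers `k =
1`. -/
theorem Represents.list_prod [DecidableEq K] [DecidableEq L] [Nonempty K] [Nonempty L]
    (hr : r x = z) (hm : m z = y) {ι : Type*} (C : ι → HomotopyGroup L X x)
    (c : ι → HomotopyGroup K Y y) (l : List ι) (h : ∀ i ∈ l, Represents e r m z (C i) (c i)) :
    Represents e r m z (l.map C).prod (l.map c).prod := by
  induction l with
  | nil => exact represents_one hr hm
  | cons i l ih =>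
    simp only [List.map_cons, List.prod_cons]
    exact (h i (by simp)).mul (ih fun i hi => h i (by simp [hi]))

/-- A filling of a loop yields a filling of any homotopic loop, of the same class if the
composite of `r` and `m` is constant. -/
theorem Represents.exists_filling [DecidableEq K] [DecidableEq L] [Nonempty K] [Nonempty L]
    (hr : r x = z) (hmr : ∀ w, m (r w) = y) (γ : GenLoop L X x) {c : HomotopyGroup K Y y}
    (hγ : Represents e r m z (loopClass γ) c) :
    ∃ (h : C(K → I, Z)) (G : GenLoop K Y y), IsFilling e r z γ h ∧
      (∀ t, G t = m (h t)) ∧ loopClass G = c := by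
  obtain ⟨γ', h, G, hh, hC, hG, rfl⟩ := hγ
  obtain ⟨H⟩ := loopClass_eq_iff.1 hC
  let κ := e.symm none
  -- The image under `r` of the homotopy from `γ'` to `γ` is stacked on top of `h`. Since `m ∘ r` is
  -- constant, this collar contributes the trivial class.
  let k : C(K → I, Z) := r.comp (H.toContinuousMap.comp
    ⟨fun t => (t κ, base e t), (continuous_apply κ).prodMk (continuous_base e)⟩)
  have hk : ∀ t, k t = r (H (t κ, base e t)) := fun _ => rfl
  have hc : ∀ t, h (Function.update t κ 1) = k (Function.update t κ 0) := by
    intro t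
    rw [hk, hh.top _ (Function.update_self ..), Function.update_self, H.apply_zero,
      base_update_none, base_update_none]
    rfl
  have wall : ∀ t, base e t ∈ Cube.boundary L → k t = z := by
    intro t ht
    rw [hk, H.eq_fst _ ht]
    exact (congrArg r (γ'.2 _ ht)).trans hr
  refine ⟨cubeConcat κ h k hc, GenLoop.transAt κ G GenLoop.const, ⟨?_, ?_, ?_⟩,
    map_cubeConcat m hG fun t => (hmr _).symm, ?_⟩
  · intro t ht
    rw [cubeConcat_of_eq_zero ht, hh.bottom t ht]
  · intro t ht
    refine cubeConcat_induction (P := fun w => w = z) (fun v => hh.wall _ ?_)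
      (fun v => wall _ ?_) <;> rwa [base_update_none]
  · intro t ht
    rw [cubeConcat_of_eq_one ht, hk, show t κ = 1 from ht, H.apply_one]
    rfl
  · rw [loopClass_transAt, loopClass_const, one_mul]

/-- If `m` maps all generalized loops to trivial ones, then two fillings of a loop have images of
the same class. -/
theorem IsFilling.loopClass_eq [DecidableEq K] [Nonempty K]
    (hnull : ∀ (f : GenLoop K Z z) (G : GenLoop K Y y), (∀ t, G t = m (f t)) → loopClass G = 1)
    {γ : GenLoop L X x} {h h' : C(K → I, Z)} (hh : IsFilling e r z γ h)
    (hh' : IsFilling e r z γ h') {G G' : GenLoop K Y y} (hG : ∀ t, G t = m (h t))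
    (hG' : ∀ t, G' t = m (h' t)) : loopClass G = loopClass G' := by
  let κ := e.symm none
  let k : C(K → I, Z) := h'.comp
    ⟨fun t => Function.update t κ (σ (t κ)), continuous_id.update κ (by fun_prop)⟩
  have hk : ∀ t, k t = h' (Function.update t κ (σ (t κ))) := fun _ => rfl
  have hc : ∀ t, h (Function.update t κ 1) = k (Function.update t κ 0) := by
    intro t
    rw [hk, hh.top _ (Function.update_self ..), Function.update_idem, Function.update_self,
      unitInterval.symm_zero, hh'.top _ (Function.update_self ..)]
  have hb : ∀ t ∈ Cube.boundary K, cubeConcat κ h k hc t = z := by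
    intro t ht
    rcases (mem_boundary_iff_base e).1 ht with h0 | h1 | hw
    · rw [cubeConcat_of_eq_zero h0, hh.bottom t h0]
    · rw [cubeConcat_of_eq_one h1, hk]
      refine hh'.bottom _ ?_
      rw [Function.update_self, show t κ = 1 from h1, unitInterval.symm_one]
    · refine cubeConcat_induction (P := fun w => w = z) (fun v => hh.wall _ ?_)
        (fun v => (hk _).trans (hh'.wall _ ?_)) <;> simpa only [κ, base_update_none] using hw
  have hs : ∀ t, GenLoop.symmAt κ G' t = m (k t) := by
    intro t
    rw [hk, ← hG']
    refine congrArg G' (funext fun j => ?_)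
    rw [Function.update_apply]
  have key := hnull ⟨cubeConcat κ h k hc, hb⟩ (GenLoop.transAt κ G (GenLoop.symmAt κ G'))
    (map_cubeConcat (H := hc) m hG hs)
  rw [loopClass_transAt, loopClass_symmAt, inv_mul_eq_one] at key
  exact key.symm

end Filling

/-! ## Homotopies of self-maps of a cube that preserve the boundary -/

section PairMaps

variable {K : Type*}

/-- The map preserves the boundary of the cube. -/
def PreservesBoundary (f : C(K → I, K → I)) : Prop :=
  ∀ t ∈ Cube.boundary K, f t ∈ Cube.boundary K

/-- Two maps which, at every boundary point, have a common coordinate that is `0` or `1`, are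
homotopic through maps that preserve the boundary. -/
theorem homotopicWith_of_common_face (f g : C(K → I, K → I))
    (h : ∀ t ∈ Cube.boundary K, ∃ κ, f t κ = g t κ ∧ (g t κ = 0 ∨ g t κ = 1)) :
    f.HomotopicWith g PreservesBoundary := by
  -- The homotopy is linear, so a coordinate common to both ends stays fixed and keeps the point on
  -- its face.
  have mem : ∀ (u a b : I), (σ u : ℝ) * a + u * b ∈ Set.Icc (0 : ℝ) 1 := fun u a b =>
    (convex_Icc (0 : ℝ) 1) a.2 b.2 (σ u).2.1 u.2.1 (by simp)
  refine ⟨⟨⟨⟨fun p κ => ⟨_, mem p.1 (f p.2 κ) (g p.2 κ)⟩, ?_⟩, fun t => ?_, fun t => ?_⟩, ?_⟩⟩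
  · refine continuous_pi fun κ => Continuous.subtype_mk ?_ _
    fun_prop
  · ext κ; simp
  · ext κ; simp
  · intro u t ht
    obtain ⟨κ, h1, h2⟩ := h t ht
    refine ⟨κ, h2.imp (fun h2 => ?_) fun h2 => ?_⟩ <;>
    · refine Subtype.ext ?_
      change (σ u : ℝ) * f t κ + u * g t κ = _
      rw [h1, h2]
      simp

end PairMaps

/-! ### The cone on `wrap` and its degree. -/

theorem expand_of_eq_zero {L : Type*} {s : L → I} {l : L} (h : s l = 0) : expand s l = 0 :=
  Set.projIcc_of_le_left _ (by rw [h]; norm_num)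

theorem expand_of_eq_one {L : Type*} {s : L → I} {l : L} (h : s l = 1) : expand s l = 1 :=
  Set.projIcc_of_right_le _ (by rw [h]; norm_num)

section Cone

variable {K L : Type*} (e : K ≃ Option L)

/-- The point of the cube `I^K` with the given height and other coordinates. -/
def withHeight (v : I) (s : L → I) : K → I := fun κ => (e κ).elim v s

@[simp] theorem withHeight_none (v : I) (s : L → I) : withHeight e v s (e.symm none) = v := by
  simp [withHeight]

@[simp] theorem withHeight_some (v : I) (s : L → I) (l : L) :
    withHeight e v s (e.symm (some l)) = s l := by
  simp [withHeight]

theorem continuous_withHeight {T : Type*} [TopologicalSpace T] {v : T → I} {s : T → L → I}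
    (hv : Continuous v) (hs : Continuous s) : Continuous fun t => withHeight e (v t) (s t) := by
  refine continuous_pi fun κ => ?_
  unfold withHeight
  cases e κ with
  | none => exact hv
  | some l => exact (continuous_apply l).comp hs

variable [Fintype L]

/-- The height of `wrap e s`. -/
noncomputable def wrapHeight (s : L → I) : I := Set.projIcc 0 1 zero_le_one (1 - 2 * excess s)

/-- The factor of contraction in `wrap e s`. -/
noncomputable def wrapScale (s : L → I) : I := Set.projIcc 0 1 zero_le_one (2 - 2 * excess s)

theorem continuous_wrapHeight : Continuous (wrapHeight : (L → I) → I) :=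
  continuous_projIcc.comp (continuous_const.sub (continuous_const.mul continuous_excess))

theorem wrap_eq (s : L → I) :
    wrap e s = withHeight e (wrapHeight s) fun l => wrapScale s * expand s l := by
  funext κ
  unfold wrap withHeight
  cases e κ <;> rfl

theorem wrapHeight_of_excess_eq_zero {s : L → I} (h : excess s = 0) : wrapHeight s = 1 :=
  Set.projIcc_of_right_le _ (by linarith)

theorem wrapHeight_of_half_le {s : L → I} (h : 1 / 2 ≤ excess s) : wrapHeight s = 0 :=
  Set.projIcc_of_le_left _ (by linarith)

theorem wrapHeight_of_mem_boundary {s : L → I} (h : s ∈ Cube.boundary L) : wrapHeight s = 0 :=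
  wrapHeight_of_half_le (by linarith [one_le_excess h])

theorem wrapScale_of_le_half {s : L → I} (h : excess s ≤ 1 / 2) : wrapScale s = 1 :=
  Set.projIcc_of_right_le _ (by linarith)

theorem expand_mem_boundary_of_mem {s : L → I} (h : s ∈ Cube.boundary L) :
    expand s ∈ Cube.boundary L :=
  expand_mem_boundary (by linarith [one_le_excess h])

/-- The cone of `wrap`, with the vertex `0` of the cube as its apex. -/
noncomputable def coneMap : C(K → I, K → I) where
  toFun t κ := t (e.symm none) * wrap e (base e t) κ
  continuous_toFun := by
    refine continuous_pi fun κ => (continuous_apply _).mul ?_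
    exact (continuous_apply κ).comp ((continuous_wrap e).comp (continuous_base e))

theorem coneMap_apply (t : K → I) (κ : K) :
    coneMap e t κ = t (e.symm none) * wrap e (base e t) κ := rfl

theorem coneMap_of_height_eq_zero {t : K → I} (ht : t (e.symm none) = 0) : coneMap e t = 0 := by
  funext κ; rw [coneMap_apply, ht, zero_mul]; rfl

theorem coneMap_of_height_eq_one {t : K → I} (ht : t (e.symm none) = 1) :
    coneMap e t = wrap e (base e t) := by
  funext κ; rw [coneMap_apply, ht, one_mul]

theorem coneMap_of_base_mem_boundary {t : K → I} (ht : base e t ∈ Cube.boundary L) :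
    coneMap e t = 0 := by
  funext κ; rw [coneMap_apply, wrap_of_mem_boundary e ht]; exact mul_zero _

/-- The map `coneMap` has degree one. -/
theorem coneMap_homotopicWith_id :
    (coneMap e).HomotopicWith (ContinuousMap.id _) PreservesBoundary := by
  have hb := continuous_base e
  have hx : Continuous fun t : K → I => expand (base e t) := continuous_expand.comp hb
  have hh : Continuous fun t : K → I => wrapHeight (base e t) := continuous_wrapHeight.comp hb
  -- Three linear stages: `f₁` drops the scaling of the base coordinates, `f₂` drops the factor
  -- `wrapHeight` of the height, and the last stage undoes `expand`.
  let f₁ : C(K → I, K → I) :=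
    ⟨fun t => withHeight e (t (e.symm none) * wrapHeight (base e t)) (expand (base e t)),
      continuous_withHeight e ((continuous_apply _).mul hh) hx⟩
  let f₂ : C(K → I, K → I) :=
    ⟨fun t => withHeight e (t (e.symm none)) (expand (base e t)),
      continuous_withHeight e (continuous_apply _) hx⟩
  have hf₁ : ∀ t, f₁ t =
    withHeight e (t (e.symm none) * wrapHeight (base e t)) (expand (base e t)) := fun _ => rfl
  have hf₂ : ∀ t, f₂ t = withHeight e (t (e.symm none)) (expand (base e t)) := fun _ => rfl
  have h₀ : (coneMap e).HomotopicWith f₁ PreservesBoundary := by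
    refine homotopicWith_of_common_face _ _ fun t ht => ?_
    have hnone : coneMap e t (e.symm none) = f₁ t (e.symm none) := by
      rw [coneMap_apply, wrap_eq, hf₁]; simp
    rcases (mem_boundary_iff_base e).1 ht with h | h | h
    · exact ⟨_, hnone, Or.inl (by rw [hf₁]; simp [h])⟩
    -- On the top face the three zones of `wrap` supply the common coordinate: height `1` on the
    -- middle subcube, a base coordinate on the walls, height `0` outside.
    · by_cases h0 : excess (base e t) = 0
      · exact ⟨_, hnone, Or.inr (by rw [hf₁]; simp [h, wrapHeight_of_excess_eq_zero h0])⟩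
      by_cases h1 : excess (base e t) ≤ 1 / 2
      · obtain ⟨l, hl⟩ := expand_mem_boundary h0
        refine ⟨e.symm (some l), ?_, by rw [hf₁]; simpa using hl⟩
        rw [coneMap_apply, wrap_eq, hf₁]
        simp [h, wrapScale_of_le_half h1]
      · exact ⟨_, hnone, Or.inl (by rw [hf₁]; simp [wrapHeight_of_half_le (not_le.1 h1).le])⟩
    · exact ⟨_, hnone, Or.inl (by rw [hf₁]; simp [wrapHeight_of_mem_boundary h])⟩
  have h₁ : f₁.HomotopicWith f₂ PreservesBoundary := by
    refine homotopicWith_of_common_face _ _ fun t ht => ?_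
    have hsome : expand (base e t) ∈ Cube.boundary L →
        ∃ κ, f₁ t κ = f₂ t κ ∧ (f₂ t κ = 0 ∨ f₂ t κ = 1) := by
      rintro ⟨l, hl⟩
      exact ⟨e.symm (some l), by rw [hf₁, hf₂]; simp, by rw [hf₂]; simpa using hl⟩
    rcases (mem_boundary_iff_base e).1 ht with h | h | h
    · exact ⟨e.symm none, by rw [hf₁, hf₂]; simp [h], Or.inl (by rw [hf₂]; simp [h])⟩
    · by_cases h0 : excess (base e t) = 0
      · exact ⟨e.symm none, by rw [hf₁, hf₂]; simp [wrapHeight_of_excess_eq_zero h0],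
          Or.inr (by rw [hf₂]; simp [h])⟩
      · exact hsome (expand_mem_boundary h0)
    · exact hsome (expand_mem_boundary_of_mem h)
  have h₂ : f₂.HomotopicWith (ContinuousMap.id _) PreservesBoundary := by
    refine homotopicWith_of_common_face _ _ fun t ht => ?_
    have hnone : f₂ t (e.symm none) = t (e.symm none) := by rw [hf₂]; simp
    rcases (mem_boundary_iff_base e).1 ht with h | h | ⟨l, h⟩
    · exact ⟨_, hnone, Or.inl h⟩
    · exact ⟨_, hnone, Or.inr h⟩
    · refine ⟨e.symm (some l), ?_, h⟩
      have : f₂ t (e.symm (some l)) = expand (base e t) l := by rw [hf₂]; simp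
      rw [this]
      rcases h with h | h
      · exact (expand_of_eq_zero (s := base e t) h).trans h.symm
      · exact (expand_of_eq_one (s := base e t) h).trans h.symm
  exact (h₀.trans h₁).trans h₂

variable {X Z Y : Type*} [TopologicalSpace X] [TopologicalSpace Z] [TopologicalSpace Y]
  {x : X} {z : Z} {y : Y} {r : C(X, Z)} {m : C(Z, Y)}

/-- An extension to the cube of the image under `r` of a map on the boundary gives a filling of
the corresponding generalized loop. -/
theorem isFilling_coneMap (hr : r x = z) (φ : C(Cube.boundary K, X)) (hφ : φ (vertex e) = x)
    (h : C(K → I, Z)) (hh : ∀ b : Cube.boundary K, h b.1 = r (φ b)) :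
    IsFilling e r z (boundaryLoop e φ hφ) (h.comp (coneMap e)) := by
  have h0 : h 0 = z := by
    rw [← hr, ← hφ]
    exact hh (vertex e)
  refine ⟨fun t ht => ?_, fun t ht => ?_, fun t ht => ?_⟩
  · rw [ContinuousMap.comp_apply, coneMap_of_height_eq_zero e ht, h0]
  · rw [ContinuousMap.comp_apply, coneMap_of_base_mem_boundary e ht, h0]
  · rw [ContinuousMap.comp_apply, coneMap_of_height_eq_one e ht]
    exact hh ⟨_, wrap_mem_boundary e _⟩

/-- Composition with `coneMap` does not change the class of a generalized loop. -/
theorem exists_loopClass_coneMap (G : GenLoop K Y y) :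
    ∃ G' : GenLoop K Y y, (∀ t, G' t = G (coneMap e t)) ∧ loopClass G' = loopClass G := by
  obtain ⟨H⟩ := coneMap_homotopicWith_id e
  have hp : ∀ (u : I), ∀ t ∈ Cube.boundary K, G (H (u, t)) = y :=
    fun u t ht => G.2 _ (H.prop u t ht)
  refine ⟨⟨G.1.comp (coneMap e), fun t ht => ?_⟩, fun _ => rfl, loopClass_eq_iff.2 ⟨⟨⟨
    G.1.comp H.toContinuousMap, fun t => ?_, fun t => ?_⟩, fun u t ht => ?_⟩⟩⟩
  · have := hp 0 t ht
    rwa [H.apply_zero] at this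
  · exact congrArg G (H.apply_zero t)
  · exact congrArg G (H.apply_one t)
  · have := hp 0 t ht
    rw [H.apply_zero] at this
    exact (hp u t ht).trans this.symm

/-- Explicit extensions over the cube give fillings by composition with `coneMap`, which does not
change the class of the image. -/
theorem represents_boundaryLoop (hr : r x = z) (φ : C(Cube.boundary K, X))
    (hφ : φ (vertex e) = x) (h : C(K → I, Z)) (hh : ∀ b : Cube.boundary K, h b.1 = r (φ b))
    (G : GenLoop K Y y) (hG : ∀ t, G t = m (h t)) :
    Represents e r m z (loopClass (boundaryLoop e φ hφ)) (loopClass G) := by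
  obtain ⟨G', h1, h2⟩ := exists_loopClass_coneMap e G
  exact ⟨_, _, G', isFilling_coneMap e hr φ hφ h hh, rfl, fun t => (h1 t).trans (hG _), h2⟩

end Cone

/-! ## Extension of maps from the boundary of a cube -/

section Extension

variable {K : Type*} [Fintype K]

/-- The sup-distance from the centre of the cube, normalized to be `1` on the boundary. -/
noncomputable def radius (t : K → I) : ℝ := ‖fun κ => 2 * (t κ : ℝ) - 1‖

theorem continuous_radius : Continuous (radius : (K → I) → ℝ) := by
  unfold radius; fun_prop

theorem abs_le_radius (t : K → I) (κ : K) : |2 * (t κ : ℝ) - 1| ≤ radius t :=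
  norm_le_pi_norm (fun κ => 2 * (t κ : ℝ) - 1) κ

theorem radius_le_one (t : K → I) : radius t ≤ 1 := by
  refine (pi_norm_le_iff_of_nonneg zero_le_one).2 fun κ => ?_
  rw [Real.norm_eq_abs, abs_le]
  constructor <;> linarith [(t κ).2.1, (t κ).2.2]

theorem radius_eq_one {t : K → I} (ht : t ∈ Cube.boundary K) : radius t = 1 := by
  refine le_antisymm (radius_le_one t) ?_
  obtain ⟨κ, h⟩ := ht
  refine le_trans ?_ (abs_le_radius t κ)
  rcases h with h | h <;> rw [h] <;> norm_num

theorem inflate_mem (t : K → I) (κ : K) :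
    (1 : ℝ) / 2 + (t κ - 1 / 2) / max (radius t) (1 / 2) ∈ Set.Icc (0 : ℝ) 1 := by
  have hpos : 0 < max (radius t) (1 / 2) := lt_max_of_lt_right (by norm_num)
  have h := (abs_le.1 ((abs_le_radius t κ).trans (le_max_left _ (1 / 2))))
  have h1 : -(1 / 2) ≤ ((t κ : ℝ) - 1 / 2) / max (radius t) (1 / 2) := by
    rw [le_div_iff₀ hpos]; linarith [h.1]
  have h2 : ((t κ : ℝ) - 1 / 2) / max (radius t) (1 / 2) ≤ 1 / 2 := by
    rw [div_le_iff₀ hpos]; linarith [h.2]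
  constructor <;> linarith

/-- The expansion by the factor `2` of the middle subcube to the whole cube, continued by the
radial projection to the boundary. -/
noncomputable def inflate (t : K → I) : K → I := fun κ => ⟨_, inflate_mem t κ⟩

theorem continuous_inflate : Continuous (inflate : (K → I) → K → I) := by
  refine continuous_pi fun κ => Continuous.subtype_mk ?_ _
  have h := continuous_radius (K := K)
  refine continuous_const.add (Continuous.div (by fun_prop) (h.max continuous_const) fun t => ?_)
  exact (lt_max_of_lt_right (by norm_num)).ne'

theorem inflate_mem_boundary {t : K → I} (ht : 1 / 2 ≤ radius t) :
    inflate t ∈ Cube.boundary K := by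
  have hpos : 0 < radius t := by linarith
  -- The sup norm is attained at some coordinate; the radial projection sends that one to `0` or
  -- `1`.
  have : ∃ κ, |2 * (t κ : ℝ) - 1| = radius t := by
    by_contra! hc
    exact lt_irrefl _ ((pi_norm_lt_iff hpos).2 fun κ =>
      lt_of_le_of_ne (abs_le_radius t κ) (hc κ))
  obtain ⟨κ, h⟩ := this
  refine ⟨κ, ?_⟩
  rcases eq_or_eq_neg_of_abs_eq h with h | h
  · refine Or.inr (Subtype.ext ?_)
    change (1 : ℝ) / 2 + (t κ - 1 / 2) / max (radius t) (1 / 2) = 1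
    rw [max_eq_left ht, show (t κ : ℝ) - 1 / 2 = radius t / 2 by linarith]
    field_simp
    norm_num
  · refine Or.inl (Subtype.ext ?_)
    change (1 : ℝ) / 2 + (t κ - 1 / 2) / max (radius t) (1 / 2) = 0
    rw [max_eq_left ht, show (t κ : ℝ) - 1 / 2 = -(radius t / 2) by linarith]
    field_simp
    norm_num

theorem inflate_of_mem_boundary {t : K → I} (ht : t ∈ Cube.boundary K) : inflate t = t := by
  funext κ
  refine Subtype.ext ?_
  change (1 : ℝ) / 2 + (t κ - 1 / 2) / max (radius t) (1 / 2) = t κ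
  rw [radius_eq_one ht]
  norm_num

variable {Z : Type*} [TopologicalSpace Z]

/-- A map on the boundary of a cube extends to the cube if its composite with a map that is
homotopic to the identity extends. -/
theorem exists_extension {f : C(K → I, K → I)}
    (hf : f.HomotopicWith (ContinuousMap.id _) PreservesBoundary) (ψ : C(Cube.boundary K, Z))
    (h : C(K → I, Z)) (hh : ∀ t ∈ Cube.boundary K, ∀ ht : f t ∈ Cube.boundary K,
      h t = ψ ⟨f t, ht⟩) :
    ∃ g : C(K → I, Z), ∀ b : Cube.boundary K, g b.1 = ψ b := by
  classical
  obtain ⟨H⟩ := hf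
  -- The middle half-size cube carries `h`. On the collar around it, the radial projection is moved
  -- by `H`, whose time runs from `0` at radius `1/2` (where the map is `ψ ∘ f`) to `1` on the
  -- boundary (where it is `ψ`).
  let D : (K → I) → K → I := fun t =>
    H (Set.projIcc 0 1 zero_le_one (2 * radius t - 1), inflate t)
  have hD : Continuous D :=
    H.continuous.comp ((continuous_projIcc.comp
      ((continuous_const.mul continuous_radius).sub continuous_const)).prodMk continuous_inflate)
  have hDm : ∀ t, 1 / 2 ≤ radius t → D t ∈ Cube.boundary K :=
    fun t ht => H.prop _ _ (inflate_mem_boundary ht)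
  let F : (K → I) → Z := fun t =>
    if ht : 1 / 2 ≤ radius t then ψ ⟨D t, hDm t ht⟩ else h (inflate t)
  have hF : ∀ t, radius t ≤ 1 / 2 → F t = h (inflate t) := by
    intro t ht
    by_cases ht' : 1 / 2 ≤ radius t
    · have h0 : D t = f (inflate t) := by
        have : Set.projIcc (0 : ℝ) 1 zero_le_one (2 * radius t - 1) = 0 :=
          Set.projIcc_of_le_left _ (by linarith)
        simp only [D, this, H.apply_zero]
      have hm : f (inflate t) ∈ Cube.boundary K := h0 ▸ hDm t ht'
      rw [hh _ (inflate_mem_boundary ht') hm]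
      simp only [F, dif_pos ht', h0]
    · exact dif_neg ht'
  have hcont : Continuous F := by
    rw [← continuousOn_univ]
    have hu : (Set.univ : Set (K → I)) = {t | radius t ≤ 1 / 2} ∪ {t | 1 / 2 ≤ radius t} := by
      ext t
      simpa using le_total _ _
    rw [hu]
    refine ContinuousOn.union_of_isClosed ?_ ?_
      (isClosed_le continuous_radius continuous_const)
      (isClosed_le continuous_const continuous_radius)
    · exact (h.continuous.comp continuous_inflate).continuousOn.congr fun t ht => hF t ht
    · rw [continuousOn_iff_continuous_domRestrict]
      have : Continuous fun t : {t : K → I | 1 / 2 ≤ radius t} => ψ ⟨D t, hDm t t.2⟩ :=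
        ψ.continuous.comp ((hD.comp continuous_subtype_val).subtype_mk _)
      refine this.congr fun t => ?_
      have ht : 1 / 2 ≤ radius t.1 := t.2
      simp only [Set.domRestrict_apply, F, dif_pos ht]
  refine ⟨⟨F, hcont⟩, fun b => ?_⟩
  have hr := radius_eq_one b.2
  have h1 : Set.projIcc (0 : ℝ) 1 zero_le_one (2 * radius b.1 - 1) = 1 :=
    Set.projIcc_of_right_le _ (by rw [hr]; norm_num)
  have hb : D b = b := by
    simp only [D, h1, inflate_of_mem_boundary b.2, H.apply_one, ContinuousMap.id_apply]
  have hle : 1 / 2 ≤ radius b.1 := by rw [hr]; norm_num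
  change F b = ψ b
  simp only [F, dif_pos hle, hb]

variable {L X : Type*} [Fintype L] [TopologicalSpace X] {x : X} {z : Z} {r : C(X, Z)}

/-- A filling of the generalized loop of a map on the boundary of a cube yields an extension of
the map to the cube. -/
theorem IsFilling.exists_extension (e : K ≃ Option L) (hr : r x = z) {φ : C(Cube.boundary K, X)}
    {hφ : φ (vertex e) = x} {h : C(K → I, Z)} (hh : IsFilling e r z (boundaryLoop e φ hφ) h) :
    ∃ g : C(K → I, Z), ∀ b : Cube.boundary K, g b.1 = r (φ b) := by
  -- On the boundary of the cube, `h` is `r ∘ φ ∘ coneMap`: `coneMap` sends the bottom and walls to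
  -- the vertex and is `wrap` on the top.
  refine CellComplexSmash.exists_extension (coneMap_homotopicWith_id e) (r.comp φ) h
    fun t ht hft => ?_
  have h0 : ∀ s : Cube.boundary K, s.1 = 0 → r (φ s) = z := by
    intro s hs
    rw [← hr, ← hφ]
    exact congrArg (fun b => r (φ b)) (Subtype.ext hs)
  rcases (mem_boundary_iff_base e).1 ht with hb | hb | hb
  · rw [hh.bottom t hb]
    exact (h0 _ (coneMap_of_height_eq_zero e hb)).symm
  · rw [hh.top t hb]
    exact congrArg (fun b => r (φ b)) (Subtype.ext (coneMap_of_height_eq_one e hb).symm)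
  · rw [hh.wall t hb]
    exact (h0 _ (coneMap_of_base_mem_boundary e hb)).symm

end Extension

/-! ## Maps out of a space with an attached cell -/

namespace AttachCell

variable {K X Z : Type*} [TopologicalSpace X] [TopologicalSpace Z] {φ : C(Cube.boundary K, X)}

theorem cell_eq_incl (b : Cube.boundary K) : cell φ b.1 = incl φ (φ b) :=
  Quot.sound (Rel.glue b)

theorem ind {P : AttachCell φ → Prop} (hincl : ∀ x, P (incl φ x)) (hcell : ∀ t, P (cell φ t))
    (q : AttachCell φ) : P q := by
  induction q using Quot.ind with
  | mk s =>
    rcases s with x | t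
    · exact hincl x
    · exact hcell t

/-- A map on `X` and an extension of its composite with `φ` to the cell define a map. -/
def lift (f : C(X, Z)) (g : C(K → I, Z)) (h : ∀ b : Cube.boundary K, g b.1 = f (φ b)) :
    C(AttachCell φ, Z) where
  toFun := Quot.lift (Sum.elim f g) (by rintro _ _ ⟨b⟩; exact h b)
  continuous_toFun := continuous_quot_lift _ (f.continuous.sumElim g.continuous)

/-- Two maps that are constant on `X` and whose restrictions to the cell are homotopic as
generalized loops are homotopic relative to `X`. -/
theorem homotopicRel_of_cell {z : Z} (f g : C(AttachCell φ, Z)) (hf : ∀ x, f (incl φ x) = z)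
    (hg : ∀ x, g (incl φ x) = z) (F G : GenLoop K Z z) (hF : ∀ t, F t = f (cell φ t))
    (hG : ∀ t, G t = g (cell φ t)) (h : GenLoop.Homotopic F G) :
    f.HomotopicRel g (Set.range (incl φ)) := by
  obtain ⟨H⟩ := h
  let Φ : I × AttachCell φ → Z := fun p =>
    Quot.lift (Sum.elim (fun _ => z) fun t => H (p.1, t)) (by
      rintro _ _ ⟨b⟩
      exact (H.eq_fst p.1 b.2).trans (F.2 _ b.2)) p.2
  have hΦ : Continuous Φ := by
    -- The product of a quotient map with the locally compact space `I` is a quotient map.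
    refine (isQuotientMap_quot_mk (r := Rel φ)).continuous_lift_prod_right ?_
    rw [← (Homeomorph.prodSumDistrib (X := I) (Y := X) (Z := K → I)).symm.comp_continuous_iff']
    exact continuous_sum_dom.2 ⟨continuous_const, H.continuous⟩
  refine ⟨⟨⟨⟨Φ, hΦ⟩, fun q => ?_, fun q => ?_⟩, ?_⟩⟩
  · induction q using ind with
    | hincl x => exact (hf x).symm
    | hcell t => exact (H.apply_zero t).trans (hF t)
  · induction q using ind with
    | hincl x => exact (hg x).symm
    | hcell t => exact (H.apply_one t).trans (hG t)
  · rintro u _ ⟨x, rfl⟩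
    exact (hf x).symm

end AttachCell

/-! ## Whitehead products of the summands of a wedge -/

section Wedge

variable {J N : Type*} [DecidableEq J]

theorem wedgeProj_mk (j i : J) (p : CubeSphere N) :
    wedgeProj N j (PtQuot.mk ⟨i, p⟩) = if i = j then p else PtQuot.pt := rfl

theorem wedgeProj_wedgeLoop (j i : J) (s : N → I) :
    wedgeProj N j (wedgeLoop N i s) = if i = j then PtQuot.mk s else PtQuot.pt := rfl

/-- The extension to the cube of the projection to the `j`-th summand of the attaching map
`S^(2n-1) → S^n ∨ S^n` into the summands `a` and `b`. -/
def bracketProj (N : Type*) (a b j : J) : C(N ⊕ N → I, CubeSphere N) :=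
  if a = j then PtQuot.mk.comp ⟨fun t => t ∘ Sum.inl, by fun_prop⟩
  else if b = j then PtQuot.mk.comp ⟨fun t => t ∘ Sum.inr, by fun_prop⟩
  else ContinuousMap.const _ PtQuot.pt

theorem bracketProj_apply (a b j : J) (t : N ⊕ N → I) :
    bracketProj N a b j t = if a = j then PtQuot.mk (t ∘ Sum.inl)
      else if b = j then PtQuot.mk (t ∘ Sum.inr) else PtQuot.pt := by
  unfold bracketProj
  split_ifs <;> rfl

/-- As `a ≠ b`, the projection sees at most one factor of the cube. Where the other factor's loop is
used instead, the visible one is on its boundary, so both sides are the base point. -/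
theorem bracketProj_eq {a b : J} (hab : a ≠ b) (j : J) (t : Cube.boundary (N ⊕ N)) :
    bracketProj N a b j t.1 =
      wedgeProj N j (whiteheadFun (wedgeLoop N a) (wedgeLoop N b) t) := by
  rw [bracketProj_apply]
  rcases Cube.boundary_sum_iff.1 t.2 with h | h
  · rw [whiteheadFun_right _ _ _ h, wedgeProj_wedgeLoop]
    by_cases ha : a = j
    · rw [if_pos ha, if_neg fun hb => hab (ha.trans hb.symm), PtQuot.mk_eq_pt h]
    · rw [if_neg ha]
  · rw [whiteheadFun_left _ _ _ h, wedgeProj_wedgeLoop, PtQuot.mk_eq_pt h, ite_self]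

variable [Finite N]

/-- The identification of the smash product of two spheres with a sphere, as a map on the
product. -/
def smashPairing (N : Type*) [Finite N] :
    C(CubeSphere N × CubeSphere N, CubeSphere (N ⊕ N)) :=
  ⟨fun p => smashFun N N p.1 p.2, continuous_smashFun N N⟩

theorem smashPairing_pt_right (p : CubeSphere N) : smashPairing N (p, PtQuot.pt) = PtQuot.pt :=
  smashFun_pt_right p

theorem smashPairing_pt_left (p : CubeSphere N) : smashPairing N (PtQuot.pt, p) = PtQuot.pt :=
  rfl

theorem smashPairing_mk (t : N ⊕ N → I) :
    smashPairing N (PtQuot.mk (t ∘ Sum.inl), PtQuot.mk (t ∘ Sum.inr)) = PtQuot.mk t :=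
  congrArg PtQuot.mk (Sum.elim_comp_inl_inr t)

/-- A point of the wedge lies in one summand, so one of the two projections is the base point. This
is the constancy of `m ∘ r` required by `Represents.exists_filling`. -/
theorem smashPairing_wedgeProj {j j' : J} (hj : j ≠ j') (w : SphereWedge J N) :
    smashPairing N (wedgeProj N j w, wedgeProj N j' w) = PtQuot.pt := by
  induction w using PtQuot.ind with
  | hpt => rfl
  | hmk p =>
    obtain ⟨i, p⟩ := p
    rw [wedgeProj_mk, wedgeProj_mk]
    by_cases h : i = j
    · rw [if_neg fun h' => hj (h.symm.trans h'), smashPairing_pt_right]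
    · rw [if_neg h, smashPairing_pt_left]

theorem smashPairing_bracketProj_self {j j' : J} (hj : j ≠ j') (t : N ⊕ N → I) :
    smashPairing N (bracketProj N j j' j t, bracketProj N j j' j' t) = PtQuot.mk t := by
  rw [bracketProj_apply, bracketProj_apply, if_pos rfl, if_neg hj, if_pos rfl, smashPairing_mk]

/-- The swapped pair must be excluded too: it would give the exchange of the two factors of the
cube. -/
theorem smashPairing_bracketProj_of_ne {a b j j' : J} (hj : j ≠ j') (h : ¬(a = j ∧ b = j'))
    (h' : ¬(a = j' ∧ b = j)) (t : N ⊕ N → I) :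
    smashPairing N (bracketProj N a b j t, bracketProj N a b j' t) = PtQuot.pt := by
  rw [bracketProj_apply, bracketProj_apply]
  by_cases haj : a = j
  · rw [if_neg fun h => hj (haj.symm.trans h), if_neg fun h'' => h ⟨haj, h''⟩,
      smashPairing_pt_right]
  · rw [if_neg haj]
    by_cases hbj : b = j
    · rw [if_neg fun h'' => h' ⟨h'', hbj⟩, if_neg fun h => hj (hbj.symm.trans h),
        smashPairing_pt_right]
    · rw [if_neg hbj, smashPairing_pt_left]

end Wedge

theorem prodMk_cell {k : ℕ} {J : Type*} [LinearOrder J] {φ : C(BdSphere k, Wedge k J)}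
    {j j' : J} (pr : CellProjection φ j) (pr' : CellProjection φ j')
    (b : BdSphere k) : (pr.1.prodMk pr'.1).comp (AttachCell.cell φ) b.1 =
      ((wedgeProj (Fin (2 * k - 1)) j).prodMk (wedgeProj _ j')) (φ b) := by
  have hc := AttachCell.cell_eq_incl (φ := φ) b
  exact Prod.ext ((congrArg pr.1 hc).trans (pr.2 _)) ((congrArg pr'.1 hc).trans (pr'.2 _))

/-! ### Existence of the projections, and the class of their smash product on the cell. -/

section Main

variable {k : ℕ} [NeZero k] {J : Type*} [LinearOrder J] {lam : J → J → ℕ}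
  {φ : C(BdSphere k, Wedge k J)}

theorem nonempty_cellProjection (hφ : IsProductOfBrackets k lam φ) (j : J) :
    Nonempty (CellProjection φ j) := by
  obtain ⟨h, l, -, hl, hprod⟩ := hφ
  let r := wedgeProj (Fin (2 * k - 1)) j
  -- Only the existence of a filling matters here, so classes are taken in a point.
  let m : C(CubeSphere (Fin (2 * k - 1)), Unit) := ContinuousMap.const _ ()
  have hr : r PtQuot.pt = PtQuot.pt := rfl
  have hm : m PtQuot.pt = () := rfl
  have hb : ∀ p ∈ l, Represents (coords k) r m PtQuot.pt
      (whiteheadBracket k p.1 p.2 ^ lam p.1 p.2) ((1 : HomotopyGroup _ Unit ()) ^ lam p.1 p.2) := by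
    intro p hp
    refine Represents.pow hr hm ?_ _
    exact represents_boundaryLoop (coords k) hr _ _ (bracketProj _ p.1 p.2 j)
      (fun b => bracketProj_eq ((hl p).1 hp).ne j b) GenLoop.const fun _ => rfl
  have hrep := Represents.list_prod hr hm _ _ l hb
  rw [← hprod] at hrep
  obtain ⟨f, -, hf, -⟩ := hrep.exists_filling hr fun _ => rfl
  obtain ⟨g, hg⟩ := hf.exists_extension (coords k) hr
  exact ⟨⟨AttachCell.lift r g hg, fun _ => rfl⟩⟩

/-- The loop given by the restriction to the cell of the smash product of two projections. -/
def cellLoop {j j' : J} (hj : j ≠ j') (pr : CellProjection φ j) (pr' : CellProjection φ j') :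
    GenLoop (Fin (2 * k - 1) ⊕ Fin (2 * k - 1))
      (CubeSphere (Fin (2 * k - 1) ⊕ Fin (2 * k - 1))) PtQuot.pt :=
  ⟨(smashPairing _).comp ((pr.1.prodMk pr'.1).comp (AttachCell.cell φ)), fun t ht => by
    exact (congrArg (smashPairing _) (prodMk_cell pr pr' ⟨t, ht⟩)).trans
      (smashPairing_wedgeProj hj _)⟩

theorem represents_whiteheadBracket {a b j j' : J} (hab : a < b) (hj : j < j') :
    Represents (coords k) ((wedgeProj (Fin (2 * k - 1)) j).prodMk (wedgeProj _ j'))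
      (smashPairing (Fin (2 * k - 1))) (PtQuot.pt, PtQuot.pt) (whiteheadBracket k a b)
      (if a = j ∧ b = j' then loopClass (idLoop (Fin (2 * k - 1) ⊕ Fin (2 * k - 1))) else 1) := by
  have hext : ∀ t : BdSphere k,
      ((bracketProj (Fin (2 * k - 1)) a b j).prodMk (bracketProj _ a b j')) t.1 =
      ((wedgeProj (Fin (2 * k - 1)) j).prodMk (wedgeProj _ j'))
        (whiteheadFun (wedgeLoop _ a) (wedgeLoop _ b) t) := fun t =>
    Prod.ext (bracketProj_eq hab.ne j t) (bracketProj_eq hab.ne j' t)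
  split_ifs with h
  · obtain ⟨rfl, rfl⟩ := h
    exact represents_boundaryLoop (coords k) rfl _ _
      ((bracketProj _ a b a).prodMk (bracketProj _ a b b)) hext
      (idLoop (Fin (2 * k - 1) ⊕ Fin (2 * k - 1)))
      fun t => (smashPairing_bracketProj_self hj.ne t).symm
  -- The swapped pair cannot occur, because `a < b` and `j < j'`.
  · exact represents_boundaryLoop (coords k) rfl _ _ _ hext GenLoop.const fun t =>
      (smashPairing_bracketProj_of_ne hj.ne h
        (fun h' => lt_asymm hj (h'.1 ▸ h'.2 ▸ hab)) t).symm

/-- Two fillings of the loop of `φ` are compared: the one given by `pr` and `pr'`, and the one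
assembled from the brackets. -/
theorem loopClass_cellLoop (hφ : IsProductOfBrackets k lam φ) {j j' : J} (hj : j < j')
    (pr : CellProjection φ j) (pr' : CellProjection φ j') :
    loopClass (cellLoop hj.ne pr pr') = loopClass (idLoop _) ^ lam j j' := by
  obtain ⟨h, l, hnodup, hl, hprod⟩ := hφ
  let r := (wedgeProj (Fin (2 * k - 1)) j).prodMk (wedgeProj (Fin (2 * k - 1)) j')
  have hr : r PtQuot.pt = (PtQuot.pt, PtQuot.pt) := rfl
  have hm : smashPairing (Fin (2 * k - 1)) (PtQuot.pt, PtQuot.pt) = PtQuot.pt := rfl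
  have hrep := Represents.list_prod hr hm _ _ l fun p hp =>
    (represents_whiteheadBracket ((hl p).1 hp) hj).pow hr hm (lam p.1 p.2)
  -- The pair `(j, j')` occurs exactly once and all other factors are trivial, so the product
  -- collapses to one power.
  have hcount : @List.count _ instBEqOfDecidableEq (j, j') l = 1 :=
    @List.count_eq_one_of_mem _ instBEqOfDecidableEq inferInstance _ _ hnodup ((hl (j, j')).2 hj)
  rw [← hprod, List.prod_map_eq_pow_single (j, j'), hcount, pow_one, if_pos ⟨rfl, rfl⟩] at hrep
  · obtain ⟨f, G, hf, hG, hGc⟩ := hrep.exists_filling hr (smashPairing_wedgeProj hj.ne)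
    obtain ⟨G', hG', hGc'⟩ := exists_loopClass_coneMap (coords k) (cellLoop hj.ne pr pr')
    rw [← hGc, ← hGc']
    refine IsFilling.loopClass_eq (m := smashPairing (Fin (2 * k - 1))) ?_
      (isFilling_coneMap (coords k) hr φ h _ (prodMk_cell pr pr')) hf hG' hG
    intro F G hFG
    exact loopClass_pairing (smashPairing (Fin (2 * k - 1))) smashPairing_pt_right
      smashPairing_pt_left ⟨ContinuousMap.fst.comp F.1, fun t ht => congrArg Prod.fst (F.2 t ht)⟩
      ⟨ContinuousMap.snd.comp F.1, fun t ht => congrArg Prod.snd (F.2 t ht)⟩ G hFG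
  · intro p hp _
    rw [if_neg fun h => hp (Prod.ext h.1 h.2), one_pow]

end Main

end CellComplexSmash

theorem mainTheorem9 (k : ℕ) [NeZero k] {J : Type*} [Finite J] [LinearOrder J]
    (lam : J → J → ℕ) (φ : C(BdSphere k, Wedge k J)) (hφ : IsProductOfBrackets k lam φ) :
    (∀ j : J, Nonempty (CellProjection φ j)) ∧
    ∀ j j' : J, j < j' → ∀ (pr : CellProjection φ j) (pr' : CellProjection φ j'),
      ContinuousMap.HomotopicRel (smashOfProjections pr pr')
        ((multipleMap (Fin (2 * k - 1) ⊕ Fin (2 * k - 1)) (lam j j')).comp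
          (AttachCell.collapse φ))
        {basePoint φ} := by
  refine ⟨nonempty_cellProjection hφ, fun j j' hj pr pr' => ?_⟩
  -- `multipleMap` is built from a chosen representative of this power, which is therefore homotopic
  -- to `cellLoop`.
  have hclass := (loopClass_cellLoop hφ hj pr pr').trans
    (Quotient.out_eq (loopClass (idLoop _) ^ lam j j')).symm
  have hincl : ∀ w, smashOfProjections pr pr' (AttachCell.incl φ w) = PtQuot.pt := by
    intro w
    change smashPairing _ (pr.1 (AttachCell.incl φ w), pr'.1 (AttachCell.incl φ w)) = _
    rw [pr.2, pr'.2]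
    exact smashPairing_wedgeProj hj.ne w
  obtain ⟨H⟩ := AttachCell.homotopicRel_of_cell (smashOfProjections pr pr')
    ((multipleMap _ (lam j j')).comp (AttachCell.collapse φ)) hincl (fun _ => rfl)
    (cellLoop hj.ne pr pr') _ (fun _ => rfl) (fun _ => rfl) (loopClass_eq_iff.1 hclass)
  -- The homotopy is relative to the whole wedge, in particular to the base point.
  exact ⟨⟨H.toHomotopy, fun u q hq => H.prop' u q (by
    obtain rfl : q = basePoint φ := hq
    exact ⟨PtQuot.pt, rfl⟩)⟩⟩
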